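/- Let $n\ge 2$ and let $\Gamma_n\subset\mathbb C^n$ be the closed symmetrized polydisc, i.e. the image of $\overline{\mathbb D}^{\,n}$ under $z\mapsto (s_1(z),\dots,s_{n-1}(z),p(z))$, where $s_i$ is the $i$-th elementary symmetric polynomial of $z_1,\dots,z_n$ and $p(z)=z_1\cdots z_n$. A *$\Gamma_n$-contraction* on a complex Hilbert space $\mathcal H$ is a commuting $n$-tuple $(S_1,\dots,S_{n-1},P)$ of bounded operators on $\mathcal H$ whose Taylor joint spectrum is contained in $\Gamma_n$ and such that $\|f(S_1,\dots,S_{n-1},P)\|\le \sup_{\Gamma_n}|f|$ for every polynomial $f$ in $n$ complex variables; it is *pure* if $P^{*k}\to 0$ strongly as $k\to\infty$. For a contraction $P$ put $D_P=(I-P^*P)^{1/2}$, $\mathcal D_P=\overline{\operatorname{Ran}}\,D_P$ and $$\Theta_P(z)=\bigl[-P+zD_{P^*}(I-zP^*)^{-1}D_P\bigr]\big|_{\mathcal D_P}:\mathcal D_P\to\mathcal D_{P^*}\qquad(|z|<1),$$ the *characteristic function* of $P$. The *fundamental operator tuple* of a $\Gamma_n$-contraction $(S_1,\dots,S_{n-1},P)$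 is the tuple $(F_1,\dots,F_{n-1})$ of bounded operators on $\mathcal D_P$ with $S_i-S_{n-i}^*P=D_PF_iD_P$ for $i=1,\dots,n-1$. **Theorem 3.14.** Let $(S_1,\dots,S_{n-1},P)$ and $(S_1',\dots,S_{n-1}',P')$ be pure $\Gamma_n$-contractions on Hilbert spaces $\mathcal H$ and $\mathcal H'$ respectively, and let $(B_1,\dots,B_{n-1})$ and $(B_1',\dots,B_{n-1}')$ be the fundamental operator tuples of the $\Gamma_n$-contractions $(S_1^*,\dots,S_{n-1}^*,P^*)$ and $(S_1'^*,\dots,S_{n-1}'^*,P'^*)$ respectively. Then there is a unitary $U:\mathcal H\to\mathcal H'$ with $US_i=S_i'U$ for $i=1,\dots,n-1$ and $UP=P'U$ if and only if there are unitary operators $u:\mathcal D_P\to\mathcal D_{P'}$ and $u_*:\mathcal D_{P^*}\to\mathcal D_{P'^*}$ such that $$u_*\Theta_P(z)=\Theta_{P'}(z)u\quad\text{for all }|z|<1\qquad\text{and}\qquad u_*B_i=B_i'u_*\quad\text{for } i=1,\dots,n-1 .$$ -/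

import Mathlib

open scoped TensorProduct InnerProduct
open Filter Topology

noncomputable section

namespace SymPoly

/-! ### The closed symmetrized polydisc -/

/-- The closed symmetrized `n`-disc: the image of the closed unit polydisc of `ℂⁿ` under the
symmetrization map. The `k`-th coordinate (counted from `0`) is the elementary symmetric
polynomial of degree `k + 1`; so the last one is the product of all `z j`. -/
def Gam (n : ℕ) : Set (Fin n → ℂ) :=
  {x | ∃ z : Fin n → ℂ, (∀ j, ‖z j‖ ≤ 1) ∧
    ∀ k : Fin n, x k = ∑ t ∈ Finset.powersetCard (k.val + 1) Finset.univ, ∏ j ∈ t, z j}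

variable {H : Type*} [NormedAddCommGroup H] [InnerProductSpace ℂ H]

/-! ### The Taylor joint spectrum -/

/-- The Koszul operator `D_T = ∑ i, T i ⊗ E i` on `H ⊗ Λ`, where `Λ` is the exterior algebra on
the `n` generators `e i` and `E i` is the creation operator `ξ ↦ e i * ξ`. -/
def koszul {n : ℕ} (T : Fin n → H →L[ℂ] H) :
    H ⊗[ℂ] ExteriorAlgebra ℂ (Fin n → ℂ) →ₗ[ℂ] H ⊗[ℂ] ExteriorAlgebra ℂ (Fin n → ℂ) :=
  ∑ i, TensorProduct.map (T i).toLinearMap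
    (LinearMap.mulLeft ℂ (ExteriorAlgebra.ι ℂ (Pi.single i (1 : ℂ) : Fin n → ℂ)))

/-- A commuting tuple is non-singular if the range of its Koszul operator is its kernel. -/
def IsNonsingular {n : ℕ} (T : Fin n → H →L[ℂ] H) : Prop :=
  LinearMap.range (koszul T) = LinearMap.ker (koszul T)

/-- The Taylor joint spectrum of a commuting tuple. -/
def taylorSpectrum {n : ℕ} (T : Fin n → H →L[ℂ] H) : Set (Fin n → ℂ) :=
  {μ | ¬ IsNonsingular fun i => T i - μ i • (1 : H →L[ℂ] H)}

/-! ### `Γ_n`-contractions -/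

/-- The value `f(T_1, …, T_n)` of a polynomial at a commuting tuple of operators. -/
def polyEval {n : ℕ} (T : Fin n → H →L[ℂ] H) (f : MvPolynomial (Fin n) ℂ) : H →L[ℂ] H :=
  ∑ d ∈ f.support, f.coeff d • (List.ofFn fun i => T i ^ d i).prod

/-- `T = (T_1, …, T_n)` is a `Γ_n`-contraction: a commuting tuple that has `Γ_n` as a spectral
set. (The supremum is over a nonempty compact set.) -/
structure IsGamContraction {n : ℕ} (T : Fin n → H →L[ℂ] H) : Prop where
  commute : ∀ i j, Commute (T i) (T j)
  spectrum_subset : taylorSpectrum T ⊆ Gam n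
  norm_le : ∀ f : MvPolynomial (Fin n) ℂ, ‖polyEval T f‖ ≤ ⨆ x : Gam n, ‖MvPolynomial.eval x.1 f‖

/-- The tuple `(S_1, …, S_m, P)`, of length `m + 1`. -/
def tuple {m : ℕ} (S : Fin m → H →L[ℂ] H) (P : H →L[ℂ] H) : Fin (m + 1) → H →L[ℂ] H :=
  Fin.snoc (α := fun _ => H →L[ℂ] H) S P

variable [CompleteSpace H]

/-- `P` is pure: the powers of the adjoint of `P` tend to `0` strongly. -/
def IsPure (P : H →L[ℂ] H) : Prop :=
  ∀ h : H, Tendsto (fun k : ℕ => ((P†) ^ k) h) atTop (𝓝 0)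

/-- `(S_1, …, S_m, P)` is a pure `Γ_n`-contraction, `n = m + 1`. -/
structure IsPureGamContraction {m : ℕ} (S : Fin m → H →L[ℂ] H) (P : H →L[ℂ] H) : Prop where
  gamContraction : IsGamContraction (tuple S P)
  pure : IsPure P

/-! ### Defect operators and fundamental operator tuples -/

/-- The defect operator `D_P = (I - P* P)^(1/2)` of a contraction. -/
def defectOp (P : H →L[ℂ] H) : H →L[ℂ] H := CFC.sqrt (1 - P† * P)

/-- The defect space: the closure of the range of `D_P`. -/
def defectSpace (P : H →L[ℂ] H) : Submodule ℂ H :=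
  (LinearMap.range (defectOp P).toLinearMap).topologicalClosure

theorem defectOp_mem (P : H →L[ℂ] H) (x : H) : defectOp P x ∈ defectSpace P :=
  Submodule.le_topologicalClosure _ ⟨x, rfl⟩

/-- The defect operator as a map from `H` to the defect space. -/
def defectMap (P : H →L[ℂ] H) : H →L[ℂ] defectSpace P :=
  (defectOp P).codRestrict (defectSpace P) (defectOp_mem P)

/-- `F = (F_1, …, F_m)` is the fundamental operator tuple of `(S_1, …, S_m, P)`, `n = m + 1`:
bounded operators on the defect space with `S_i - S_{n-i}* P = D_P F_i D_P` for all `i`.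
With indices from `0`, the index `n - i` is `Fin.rev i`. -/
def IsFundamentalTuple {m : ℕ} (S : Fin m → H →L[ℂ] H) (P : H →L[ℂ] H)
    (F : Fin m → defectSpace P →L[ℂ] defectSpace P) : Prop :=
  ∀ i : Fin m, S i - (S (Fin.rev i))† * P =
    defectOp P ∘L (defectSpace P).subtypeL ∘L F i ∘L defectMap P

/-! ### The characteristic function -/

theorem defectOp_sq {P : H →L[ℂ] H} (h : 0 ≤ 1 - P† * P) :
    defectOp P * defectOp P = 1 - P† * P :=
  CFC.sqrt_mul_sqrt_self _ h

theorem defectOp_adjoint (P : H →L[ℂ] H) : (defectOp P)† = defectOp P :=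
  (IsSelfAdjoint.of_nonneg (CFC.sqrt_nonneg (1 - P† * P))).star_eq

theorem defect_nonneg_adjoint {P : H →L[ℂ] H} (h : 0 ≤ 1 - P† * P) : 0 ≤ 1 - P†† * P† := by
  have key : ∀ Q : H →L[ℂ] H, 0 ≤ 1 - Q† * Q ↔ ‖Q‖ ≤ 1 := by
    intro Q
    have e : Q† * Q = star Q * Q := rfl
    rw [sub_nonneg, e, ← CStarAlgebra.norm_le_one_iff_of_nonneg _ (star_mul_self_nonneg Q),
      CStarRing.norm_star_mul_self, ← sq, sq_le_one_iff₀ (norm_nonneg _)]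
  rw [key] at h ⊢
  simpa using h

/-- `P` maps the defect space of `P` into that of its adjoint. -/
theorem map_defectSpace (P : H →L[ℂ] H) {x : H} (hx : x ∈ defectSpace P) :
    P x ∈ defectSpace (P†) := by
  by_cases h : 0 ≤ 1 - P† * P
  · have h' := defect_nonneg_adjoint h
    -- the range of `D_P` is contained in the closure of the range of `1 - P† P`
    have h1 : (LinearMap.range (1 - P† * P).toLinearMap)ᗮ ≤
        (LinearMap.range (defectOp P).toLinearMap)ᗮ := by
      intro y hy
      rw [Submodule.mem_orthogonal] at hy ⊢
      have h2 : defectOp P y = 0 := by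
        have := hy ((1 - P† * P) y) ⟨y, rfl⟩
        rw [← defectOp_sq h] at this
        rw [mul_apply_eq_comp] at this
        rw [← inner_self_eq_zero (𝕜 := ℂ), ← this]
        nth_rewrite 3 [← defectOp_adjoint P]
        rw [ContinuousLinearMap.adjoint_inner_left]
      rintro _ ⟨w, rfl⟩
      change inner ℂ (defectOp P w) y = 0
      rw [← defectOp_adjoint P, ContinuousLinearMap.adjoint_inner_left, h2, inner_zero_right]
    have h2 : x ∈ (LinearMap.range (1 - P† * P).toLinearMap).topologicalClosure := by
      rw [← Submodule.orthogonal_orthogonal_eq_closure]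
      refine Submodule.orthogonal_le h1 ?_
      rw [Submodule.orthogonal_orthogonal_eq_closure]
      exact hx
    refine map_mem_closure P.continuous h2 ?_
    rintro _ ⟨w, rfl⟩
    refine ⟨defectOp (P†) (P w), ?_⟩
    change (defectOp (P†) * defectOp (P†)) (P w) = P ((1 - P† * P) w)
    rw [defectOp_sq h']
    simp
  · have h0 : defectOp P = 0 := cfcₙ_apply_of_not_predicate _ h
    have : x = 0 := by
      have hx' := hx
      have e : LinearMap.range (0 : H →L[ℂ] H).toLinearMap = ⊥ := LinearMap.range_zero
      rw [defectSpace, h0, e, IsClosed.submodule_topologicalClosure_eq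
        (by simp)] at hx'
      simpa using hx'
    rw [this, map_zero]
    exact zero_mem _

/-- The operator `-P + z D_{P*} (I - z P*)⁻¹ D_P` on `H`. -/
def charOp (P : H →L[ℂ] H) (z : ℂ) : H →L[ℂ] H :=
  -P + z • (defectOp (P†) * Ring.inverse (1 - z • P†) * defectOp P)

theorem charOp_mem (P : H →L[ℂ] H) (z : ℂ) (x : defectSpace P) :
    charOp P z x ∈ defectSpace (P†) :=
  add_mem (neg_mem (map_defectSpace P x.2)) (Submodule.smul_mem _ _ (defectOp_mem _ _))

/-- The characteristic function `Θ_P(z) = [-P + z D_{P*} (I - z P*)⁻¹ D_P]|_{𝒟_P}` of a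
contraction `P`, at a point `z` of the open unit disc, as an operator from the defect space of `P`
to that of its adjoint. -/
def charFun (P : H →L[ℂ] H) (z : ℂ) : defectSpace P →L[ℂ] defectSpace (P†) :=
  (charOp P z ∘L (defectSpace P).subtypeL).codRestrict (defectSpace (P†)) (charOp_mem P z)

/-! ### Unitary equivalence and coincidence -/

variable {H' : Type*} [NormedAddCommGroup H'] [InnerProductSpace ℂ H'] [CompleteSpace H']

/-- The unitary `U` intertwines the two operator tuples. -/
def Intertwines {ι E E' : Type*} [NormedAddCommGroup E] [InnerProductSpace ℂ E]
    [NormedAddCommGroup E'] [InnerProductSpace ℂ E'] (U : E ≃ₗᵢ[ℂ] E')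
    (T : ι → E →L[ℂ] E) (T' : ι → E' →L[ℂ] E') : Prop :=
  ∀ i x, U (T i x) = T' i (U x)

/-- Unitary equivalence of operator tuples. -/
def UnitarilyEquivalent {ι E E' : Type*} [NormedAddCommGroup E] [InnerProductSpace ℂ E]
    [NormedAddCommGroup E'] [InnerProductSpace ℂ E']
    (T : ι → E →L[ℂ] E) (T' : ι → E' →L[ℂ] E') : Prop :=
  ∃ U : E ≃ₗᵢ[ℂ] E', Intertwines U T T'

/-- The characteristic functions of `P` and `P'` coincide by means of the unitaries `u` and `v`
(`v` is the one usually written `u` with a star as subscript). -/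
def CoincideVia (P : H →L[ℂ] H) (P' : H' →L[ℂ] H')
    (u : defectSpace P ≃ₗᵢ[ℂ] defectSpace P')
    (v : defectSpace (P†) ≃ₗᵢ[ℂ] defectSpace (P'†)) : Prop :=
  ∀ z : ℂ, ‖z‖ < 1 → ∀ x : defectSpace P, v (charFun P z x) = charFun P' z (u x)

end SymPoly

end

/-!
The proof replaces the Hardy space model of a pure contraction `P` by the family of vectors
`Pᵏ D_{P*} e`, where `k ∈ ℕ` and `e` runs over the defect space of `P*`. Purity makes these
vectors total in the Hilbert space (`IsPure.eq_zero_of_inner_orbitMap`), so everything can be read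
off from three facts.

* Their inner products depend only on the characteristic function `Θ` of `P`. Comparing Taylor
  coefficients in
  `(1 - z w̄) D_{P*} (I - z P*)⁻¹ (I - w̄ P)⁻¹ D_{P*} = I - Θ(z) Θ(w)*` gives a recursion for the
  Gram operators in terms of the coefficients of `Θ`; hence unitaries under which two
  characteristic functions coincide preserve the inner products (`CoincideVia.inner_orbitMap`).
* `P` acts on them as the shift `k ↦ k + 1`.
* `S_i` acts on them through the fundamental operators `B` of the adjoint tuple:
  `S_i Pᵏ D_{P*} e = Pᵏ D_{P*} B_i* e + Pᵏ⁺¹ D_{P*} B_{n-i} e`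
  (`IsFundamentalTuple.apply_orbitMap`).

Given `u` and `v`, the assignment `Pᵏ D_{P*} e ↦ P'ᵏ D_{P'*} (v e)` therefore extends to a unitary
(`exists_unitary_of_gram_eq`), and it intertwines the tuples (`intertwines_of_map_orbitMap`).

Conversely, a unitary `U` that intertwines the tuples intertwines the defect operators, hence
restricts to unitaries of the defect spaces (`exists_defectSpace_unitary`). These make the
characteristic functions coincide, and they intertwine the fundamental operators because a bounded
operator `F` on the defect space is determined by `D_{P*} F D_{P*}`.

Both `U D_P = D_{P'} U` and `D_{P*} P = P D_P` are instances of the fact that an operator which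
intertwines the squares of two nonnegative operators intertwines these operators
(`comp_eq_comp_of_sq`). Of the defining properties of a `Γ_n`-contraction the argument needs that
the operators commute and that `‖P‖ ≤ 1`, the latter by the spectral set inequality for the last
coordinate function.
-/

noncomputable section

namespace SymPoly

variable {H : Type*} [NormedAddCommGroup H] [InnerProductSpace ℂ H]
variable {H' : Type*} [NormedAddCommGroup H'] [InnerProductSpace ℂ H']
variable {E : Type*} [NormedAddCommGroup E] [InnerProductSpace ℂ E]
variable {E' : Type*} [NormedAddCommGroup E'] [InnerProductSpace ℂ E']

/-! ### Operators between Hilbert spaces -/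

theorem adjoint_comp_self_eq_zero [CompleteSpace H] [CompleteSpace H'] {T : H →L[ℂ] H'}
    (h : T† ∘L T = 0) : T = 0 := by
  ext x
  have := T.apply_norm_sq_eq_inner_adjoint_left x
  rw [h] at this
  simpa using this

/-- A homogeneous Sylvester equation `A T + T B = 0` with `A, B ≥ 0` forces `A T = T B = 0`. -/
theorem comp_eq_zero_of_comp_eq_neg [CompleteSpace H] [CompleteSpace H'] {A : H' →L[ℂ] H'}
    {B : H →L[ℂ] H} (hA : 0 ≤ A) (hB : 0 ≤ B) {T : H →L[ℂ] H'} (h : A ∘L T = -(T ∘L B)) :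
    T ∘L B = 0 := by
  have hA' := (ContinuousLinearMap.nonneg_iff_isPositive A).1 hA
  have hBa : B† = B := ((ContinuousLinearMap.nonneg_iff_isPositive B).1 hB).isSelfAdjoint.star_eq
  have hpos : 0 ≤ T† ∘L A ∘L T :=
    (ContinuousLinearMap.nonneg_iff_isPositive _).2 (hA'.adjoint_conj T)
  have hTT : 0 ≤ T† ∘L T :=
    (ContinuousLinearMap.nonneg_iff_isPositive _).2
      (ContinuousLinearMap.isPositive_adjoint_comp_self T)
  have hTTa : (T† ∘L T)† = T† ∘L T := by simp [ContinuousLinearMap.adjoint_comp]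
  have e : (T† ∘L T) * B = -(T† ∘L A ∘L T) := by
    rw [h, ContinuousLinearMap.comp_neg, neg_neg]; rfl
  -- `T†TB = -T†AT` is self-adjoint, so `T†T` and `B` commute and their product is nonnegative
  have e' : B * (T† ∘L T) = -(T† ∘L A ∘L T) := by
    have := congrArg ContinuousLinearMap.adjoint e
    rw [map_neg] at this
    rw [show (T† ∘L A ∘L T)† = T† ∘L A ∘L T from
      ((ContinuousLinearMap.nonneg_iff_isPositive _).1 hpos).isSelfAdjoint.star_eq] at this
    rw [← this]
    change _ = ((T† ∘L T) ∘L B)†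
    rw [ContinuousLinearMap.adjoint_comp, hTTa, hBa]
    rfl
  have hc : Commute (T† ∘L T) B := e.trans e'.symm
  have h0 : (T† ∘L T) * B = 0 := by
    refine le_antisymm ?_ (hc.mul_nonneg hTT hB)
    rw [e]
    exact neg_nonpos.2 hpos
  apply adjoint_comp_self_eq_zero
  rw [ContinuousLinearMap.adjoint_comp]
  calc (B† ∘L T†) ∘L T ∘L B = B† ∘L ((T† ∘L T) * B) := rfl
    _ = 0 := by rw [h0, ContinuousLinearMap.comp_zero]

/-- An operator that intertwines the squares of two nonnegative operators intertwines these
operators themselves. -/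
theorem comp_eq_comp_of_sq [CompleteSpace H] [CompleteSpace H'] {A : H' →L[ℂ] H'}
    {B : H →L[ℂ] H} (hA : 0 ≤ A) (hB : 0 ≤ B) {X : H →L[ℂ] H'}
    (h : (A * A) ∘L X = X ∘L (B * B)) : A ∘L X = X ∘L B := by
  have hAa : A† = A := ((ContinuousLinearMap.nonneg_iff_isPositive A).1 hA).isSelfAdjoint.star_eq
  have hBa : B† = B := ((ContinuousLinearMap.nonneg_iff_isPositive B).1 hB).isSelfAdjoint.star_eq
  rw [← sub_eq_zero]
  set T := A ∘L X - X ∘L B with hT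
  have h1 : A ∘L T = -(T ∘L B) := by
    rw [hT, ContinuousLinearMap.comp_sub, ContinuousLinearMap.sub_comp]
    have : A ∘L A ∘L X = (X ∘L B) ∘L B := h
    rw [this, neg_sub]
    rfl
  have h2 : T ∘L B = 0 := comp_eq_zero_of_comp_eq_neg hA hB h1
  have h3 : A ∘L T = 0 := by rw [h1, h2, neg_zero]
  have h4 : B ∘L T† = 0 := by
    have := congrArg ContinuousLinearMap.adjoint h2
    rwa [ContinuousLinearMap.adjoint_comp, hBa, map_zero] at this
  have h5 : T† ∘L A = 0 := by
    have := congrArg ContinuousLinearMap.adjoint h3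
    rwa [ContinuousLinearMap.adjoint_comp, hAa, map_zero] at this
  have h6 : (T† ∘L T) ∘L T† = 0 := by
    nth_rewrite 2 [hT]
    rw [ContinuousLinearMap.comp_sub, ContinuousLinearMap.sub_comp]
    calc (T† ∘L A ∘L X) ∘L T† - (T† ∘L X ∘L B) ∘L T†
        = ((T† ∘L A) ∘L X) ∘L T† - T† ∘L X ∘L B ∘L T† := rfl
      _ = 0 := by simp [h4, h5]
  have h7 : T† ∘L T = 0 := by
    apply adjoint_comp_self_eq_zero
    rw [ContinuousLinearMap.adjoint_comp, ContinuousLinearMap.adjoint_adjoint]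
    calc (T† ∘L T) ∘L (T† ∘L T) = ((T† ∘L T) ∘L T†) ∘L T := rfl
      _ = 0 := by rw [h6, ContinuousLinearMap.zero_comp]
  exact adjoint_comp_self_eq_zero h7

/-- If unitaries intertwine two operators, they intertwine the adjoints. -/
theorem map_adjoint_of_intertwines {F F' : Type*} [NormedAddCommGroup F] [InnerProductSpace ℂ F]
    [NormedAddCommGroup F'] [InnerProductSpace ℂ F'] [CompleteSpace F] [CompleteSpace F']
    [CompleteSpace E] [CompleteSpace E'] {T : E →L[ℂ] F} {T' : E' →L[ℂ] F'}
    (u : E ≃ₗᵢ[ℂ] E') (v : F ≃ₗᵢ[ℂ] F') (h : ∀ x, v (T x) = T' (u x)) (y : F) :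
    u ((T†) y) = (T'†) (v y) := by
  refine ext_inner_left ℂ fun x => ?_
  obtain ⟨x, rfl⟩ := u.surjective x
  rw [u.inner_map_map, ContinuousLinearMap.adjoint_inner_right,
    ContinuousLinearMap.adjoint_inner_right, ← h, v.inner_map_map]

/-- Finite sums of vectors from the ranges of a family of operators are dense if only `0` is
orthogonal to all these ranges. -/
theorem denseRange_lsum [CompleteSpace H] {ι : Type*} (a : ι → E →L[ℂ] H)
    (ha : ∀ h, (∀ k e, inner ℂ (a k e) h = 0) → h = 0) :
    DenseRange (Finsupp.lsum ℂ fun k => (a k).toLinearMap) := by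
  have : (LinearMap.range (Finsupp.lsum ℂ fun k => (a k).toLinearMap)).topologicalClosure = ⊤ := by
    rw [Submodule.topologicalClosure_eq_top_iff, Submodule.eq_bot_iff]
    intro h hh
    refine ha h fun k e => ?_
    exact (Submodule.mem_orthogonal _ _).1 hh _ ⟨Finsupp.single k e, by simp⟩
  exact Submodule.dense_iff_topologicalClosure_eq_top.2 this

/-- Two families of operators `a k : E → H` and `a' k : E' → H'` whose ranges are total and whose
Gram operators correspond under a unitary `v` are intertwined by `v` and a unitary `H → H'`. -/
theorem exists_unitary_of_gram_eq [CompleteSpace H] [CompleteSpace H'] {ι : Type*}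
    (a : ι → E →L[ℂ] H) (a' : ι → E' →L[ℂ] H') (v : E ≃ₗᵢ[ℂ] E')
    (hgram : ∀ j k e f, inner ℂ (a' j (v e)) (a' k (v f)) = inner ℂ (a j e) (a k f))
    (ha : ∀ h, (∀ k e, inner ℂ (a k e) h = 0) → h = 0)
    (ha' : ∀ h, (∀ k e, inner ℂ (a' k e) h = 0) → h = 0) :
    ∃ U : H ≃ₗᵢ[ℂ] H', ∀ k e, U (a k e) = a' k (v e) := by
  let f : (ι →₀ E) ≃ₗ[ℂ] (ι →₀ E') := Finsupp.mapRange.linearEquiv v.toLinearEquiv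
  let e₁ : (ι →₀ E) →ₗ[ℂ] H := Finsupp.lsum ℂ fun k => (a k).toLinearMap
  let e₂ : (ι →₀ E') →ₗ[ℂ] H' := Finsupp.lsum ℂ fun k => (a' k).toLinearMap
  have hf : ∀ x, e₂ (f x) = x.sum fun k e => a' k (v e) := by
    intro x
    simp only [e₂, f, Finsupp.mapRange.linearEquiv_apply, Finsupp.lsum_apply]
    rw [Finsupp.sum_mapRange_index (by simp)]
    rfl
  have hn : ∀ x, ‖e₂ (f x)‖ = ‖e₁ x‖ := by
    intro x
    rw [hf, ← sq_eq_sq₀ (norm_nonneg _) (norm_nonneg _), ← Complex.ofReal_inj]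
    push_cast
    have e1 := inner_self_eq_norm_sq_to_K (𝕜 := ℂ) (e₁ x)
    have e2 := inner_self_eq_norm_sq_to_K (𝕜 := ℂ) (x.sum fun k e => a' k (v e))
    refine e2.symm.trans (Eq.trans ?_ e1)
    change inner ℂ (x.sum fun k e => a' k (v e)) (x.sum fun k e => a' k (v e)) =
      inner ℂ (x.sum fun k e => a k e) (x.sum fun k e => a k e)
    simp only [Finsupp.sum, sum_inner, inner_sum, hgram]
  refine ⟨f.extendOfIsometry e₁ e₂ (denseRange_lsum a ha) (denseRange_lsum a' ha') hn,
    fun k e => ?_⟩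
  have := f.extendOfIsometry_eq e₁ e₂ (denseRange_lsum a ha) (denseRange_lsum a' ha') hn
    (Finsupp.single k e)
  rw [hf] at this
  simpa [e₁] using this

/-! ### `Γ_n`-contractions: the last operator is a contraction -/

theorem polyEval_X_last {m : ℕ} (T : Fin (m + 1) → H →L[ℂ] H) :
    polyEval T (MvPolynomial.X (Fin.last m)) = T (Fin.last m) := by
  have h : (List.ofFn fun j => T j ^ (Finsupp.single (Fin.last m) 1 : Fin (m + 1) →₀ ℕ) j).prod =
      T (Fin.last m) := by
    rw [List.ofFn_succ', List.concat_eq_append, List.prod_append, List.prod_eq_one]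
    · simp
    · intro x hx
      obtain ⟨j, rfl⟩ := (List.mem_ofFn' _ _).1 hx
      simp [Finsupp.single_eq_of_ne, (Fin.castSucc_lt_last j).ne]
  rw [polyEval, MvPolynomial.support_X, Finset.sum_singleton, h]
  simp

theorem norm_last_le_one_of_mem_Gam {m : ℕ} {x : Fin (m + 1) → ℂ} (hx : x ∈ Gam (m + 1)) :
    ‖x (Fin.last m)‖ ≤ 1 := by
  obtain ⟨z, hz, h⟩ := hx
  have e : Finset.powersetCard ((Fin.last m).val + 1) (Finset.univ : Finset (Fin (m + 1))) =
      {Finset.univ} := by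
    have := Finset.powersetCard_self (Finset.univ : Finset (Fin (m + 1)))
    rwa [Finset.card_univ, Fintype.card_fin] at this
  rw [h, e, Finset.sum_singleton, norm_prod]
  exact Finset.prod_le_one (fun _ _ => norm_nonneg _) fun j _ => hz j

theorem IsGamContraction.norm_last_le_one {m : ℕ} {T : Fin (m + 1) → H →L[ℂ] H}
    (hT : IsGamContraction T) : ‖T (Fin.last m)‖ ≤ 1 := by
  have h := hT.norm_le (MvPolynomial.X (Fin.last m))
  rw [polyEval_X_last] at h
  refine h.trans (Real.iSup_le (fun x => ?_) zero_le_one)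
  simpa using norm_last_le_one_of_mem_Gam x.2

theorem IsPureGamContraction.norm_le_one [CompleteSpace H] {m : ℕ} {S : Fin m → H →L[ℂ] H}
    {P : H →L[ℂ] H} (h : IsPureGamContraction S P) : ‖P‖ ≤ 1 := by
  simpa [tuple] using h.gamContraction.norm_last_le_one

theorem IsPureGamContraction.commute [CompleteSpace H] {m : ℕ} {S : Fin m → H →L[ℂ] H}
    {P : H →L[ℂ] H} (h : IsPureGamContraction S P) (i : Fin m) : Commute (S i) P := by
  simpa [tuple] using h.gamContraction.commute i.castSucc (Fin.last m)

/-! ### Defect operators -/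

variable [CompleteSpace H] [CompleteSpace H']

theorem defect_nonneg {P : H →L[ℂ] H} (hP : ‖P‖ ≤ 1) : 0 ≤ 1 - P† * P := by
  have e : P† * P = star P * P := rfl
  rw [sub_nonneg, e, ← CStarAlgebra.norm_le_one_iff_of_nonneg _ (star_mul_self_nonneg P),
    CStarRing.norm_star_mul_self]
  exact mul_le_one₀ hP (norm_nonneg _) hP

theorem defectOp_mul_self {P : H →L[ℂ] H} (hP : ‖P‖ ≤ 1) :
    defectOp P * defectOp P = 1 - P† * P := defectOp_sq (defect_nonneg hP)

theorem defectOp_adjoint_mul_self {P : H →L[ℂ] H} (hP : ‖P‖ ≤ 1) :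
    defectOp (P†) * defectOp (P†) = 1 - P * P† := by
  have := defectOp_sq (P := P†) (defect_nonneg (by simpa using hP))
  rwa [ContinuousLinearMap.adjoint_adjoint] at this

theorem defectOp_nonneg (P : H →L[ℂ] H) : 0 ≤ defectOp P := CFC.sqrt_nonneg _

instance (P : H →L[ℂ] H) : CompleteSpace (defectSpace P) :=
  (Submodule.isClosed_topologicalClosure _).completeSpace_coe

@[simp]
theorem coe_defectMap (P : H →L[ℂ] H) (x : H) : (defectMap P x : H) = defectOp P x := rfl

theorem adjoint_defectMap_apply (P : H →L[ℂ] H) (x : defectSpace P) :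
    ((defectMap P)†) x = defectOp P x := by
  refine ext_inner_left ℂ fun y => ?_
  rw [ContinuousLinearMap.adjoint_inner_right]
  change inner ℂ (defectOp P y) (x : H) = _
  nth_rewrite 1 [← defectOp_adjoint P]
  rw [ContinuousLinearMap.adjoint_inner_left]

theorem denseRange_defectMap (P : H →L[ℂ] H) : DenseRange (defectMap P) := by
  intro x
  rw [closure_subtype]
  have hx : (x : H) ∈ closure (LinearMap.range (defectOp P).toLinearMap : Set H) := x.2
  convert! hx
  ext y
  constructor
  · rintro ⟨_, ⟨w, rfl⟩, rfl⟩
    exact ⟨w, rfl⟩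
  · rintro ⟨w, rfl⟩
    exact ⟨defectMap P w, ⟨w, rfl⟩, rfl⟩

/-- `D_P` is injective on the closure of its range. -/
theorem defectOp_injOn {P : H →L[ℂ] H} {x y : defectSpace P}
    (h : defectOp P x = defectOp P y) : x = y := by
  rw [← adjoint_defectMap_apply, ← adjoint_defectMap_apply] at h
  refine (denseRange_defectMap P).eq_of_inner_right ℂ fun w => ?_
  rw [← ContinuousLinearMap.adjoint_inner_right, h, ContinuousLinearMap.adjoint_inner_right]

/-- `D_{P*} P = P D_P`. -/
theorem defectOp_adjoint_mul {P : H →L[ℂ] H} (hP : ‖P‖ ≤ 1) :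
    defectOp (P†) * P = P * defectOp P := by
  refine comp_eq_comp_of_sq (defectOp_nonneg _) (defectOp_nonneg _) ?_
  rw [defectOp_mul_self hP, defectOp_adjoint_mul_self hP]
  change (1 - P * P†) * P = P * (1 - P† * P)
  noncomm_ring

/-- If `U` intertwines the contractions, it intertwines their defect operators. -/
theorem map_defectOp {P : H →L[ℂ] H} {P' : H' →L[ℂ] H'} (hP : ‖P‖ ≤ 1) (hP' : ‖P'‖ ≤ 1)
    (U : H ≃ₗᵢ[ℂ] H') (h : ∀ x, U (P x) = P' (U x)) (x : H) :
    U (defectOp P x) = defectOp P' (U x) := by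
  let X : H →L[ℂ] H' := U.toContinuousLinearEquiv
  have key : defectOp P' ∘L X = X ∘L defectOp P := by
    refine comp_eq_comp_of_sq (defectOp_nonneg _) (defectOp_nonneg _) ?_
    rw [defectOp_mul_self hP, defectOp_mul_self hP']
    ext y
    change U y - (P'†) (P' (U y)) = U (y - (P†) (P y))
    rw [map_sub, map_adjoint_of_intertwines U U h, h]
  exact (DFunLike.congr_fun key x).symm

theorem map_mem_defectSpace {P : H →L[ℂ] H} {P' : H' →L[ℂ] H'} (hP : ‖P‖ ≤ 1) (hP' : ‖P'‖ ≤ 1)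
    (U : H ≃ₗᵢ[ℂ] H') (h : ∀ x, U (P x) = P' (U x)) {x : H} (hx : x ∈ defectSpace P) :
    U x ∈ defectSpace P' := by
  refine map_mem_closure U.continuous hx ?_
  rintro _ ⟨w, rfl⟩
  exact ⟨U w, (map_defectOp hP hP' U h w).symm⟩

/-- A unitary that intertwines two contractions restricts to a unitary between their defect
spaces. -/
theorem exists_defectSpace_unitary {P : H →L[ℂ] H} {P' : H' →L[ℂ] H'} (hP : ‖P‖ ≤ 1)
    (hP' : ‖P'‖ ≤ 1) (U : H ≃ₗᵢ[ℂ] H') (h : ∀ x, U (P x) = P' (U x)) :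
    ∃ u : defectSpace P ≃ₗᵢ[ℂ] defectSpace P', ∀ x, (u x : H') = U x := by
  have hmap : (defectSpace P).map (U.toLinearEquiv : H →ₗ[ℂ] H') = defectSpace P' := by
    ext y
    constructor
    · rintro ⟨x, hx, rfl⟩
      exact map_mem_defectSpace hP hP' U h hx
    · intro hy
      refine ⟨U.symm y, map_mem_defectSpace hP' hP U.symm (fun x => ?_) hy, U.apply_symm_apply y⟩
      rw [U.symm_apply_eq, h, U.apply_symm_apply]
  let e := U.toLinearEquiv.submoduleMap (defectSpace P)
  exact ⟨⟨e.trans (LinearEquiv.ofEq _ _ hmap), fun x => U.norm_map x⟩, fun x => rfl⟩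

/-! ### Taylor coefficients of the characteristic function -/

/-- The function `z ↦ D_{P*} P*ⁿ (I - z P*)⁻¹ D_P`, the `n + 1`-st difference quotient at `0` of the
characteristic function of `P`. Its value at `0` is the Taylor coefficient of degree `n + 1`. -/
def charRemainder (P : H →L[ℂ] H) (n : ℕ) (z : ℂ) : defectSpace P →L[ℂ] defectSpace (P†) :=
  defectMap (P†) ∘L (P† ^ n * Ring.inverse (1 - z • P†)) ∘L (defectMap P)†

theorem charFun_zero_apply (P : H →L[ℂ] H) (x : defectSpace P) :
    (charFun P 0 x : H) = -P x := by
  change charOp P 0 x = -P x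
  simp [charOp]

theorem charFun_eq_add (P : H →L[ℂ] H) (z : ℂ) :
    charFun P z = charFun P 0 + z • charRemainder P 0 z := by
  ext x
  change charOp P z x = charFun P 0 x + z • (charRemainder P 0 z x : H)
  rw [charFun_zero_apply]
  simp [charOp, charRemainder, adjoint_defectMap_apply]

theorem isUnit_one_sub_smul_adjoint {P : H →L[ℂ] H} (hP : ‖P‖ ≤ 1) {z : ℂ} (hz : ‖z‖ < 1) :
    IsUnit (1 - z • P†) := by
  refine isUnit_one_sub_of_norm_lt_one ?_
  rw [norm_smul, LinearIsometryEquiv.norm_map]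
  nlinarith [norm_nonneg z, norm_nonneg P]

theorem charRemainder_eq_add {P : H →L[ℂ] H} (hP : ‖P‖ ≤ 1) (n : ℕ) {z : ℂ} (hz : ‖z‖ < 1) :
    charRemainder P n z = charRemainder P n 0 + z • charRemainder P (n + 1) z := by
  have h := isUnit_one_sub_smul_adjoint hP hz
  have e : Ring.inverse (1 - z • P†) = 1 + z • (P† * Ring.inverse (1 - z • P†)) := by
    have := Ring.mul_inverse_cancel _ h
    rw [sub_mul, one_mul, sub_eq_iff_eq_add, smul_mul_assoc] at this
    exact this
  have e' : P† ^ n * Ring.inverse (1 - z • P†) =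
      P† ^ n + z • (P† ^ (n + 1) * Ring.inverse (1 - z • P†)) := by
    conv_lhs => rw [e]
    rw [mul_add, mul_one, mul_smul_comm, ← mul_assoc, pow_succ]
  rw [charRemainder, e']
  ext x
  simp [charRemainder]

theorem continuousAt_charRemainder (P : H →L[ℂ] H) (n : ℕ) (x : defectSpace P) :
    ContinuousAt (fun z => charRemainder P n z x) 0 := by
  have h : ContinuousAt (fun z : ℂ => Ring.inverse (1 - z • P†)) 0 := by
    refine ContinuousAt.comp (f := fun z : ℂ => 1 - z • P†) (g := Ring.inverse) ?_ (by fun_prop)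
    simpa using NormedRing.inverse_continuousAt (1 : (H →L[ℂ] H)ˣ)
  change ContinuousAt (fun z => defectMap (P†)
    ((P† ^ n) ((Ring.inverse (1 - z • P†) : H →L[ℂ] H) (((defectMap P)†) x)))) 0
  exact ((defectMap (P†)).continuous.comp (P† ^ n).continuous).continuousAt.comp
    (h.clm_apply continuousAt_const)

/-- If two characteristic functions coincide, so do their Taylor coefficients of positive degree:
by induction the difference quotients at `0` coincide on the punctured disc. -/
theorem CoincideVia.charRemainder_zero {P : H →L[ℂ] H} {P' : H' →L[ℂ] H'} (hP : ‖P‖ ≤ 1)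
    (hP' : ‖P'‖ ≤ 1) {u : defectSpace P ≃ₗᵢ[ℂ] defectSpace P'}
    {v : defectSpace (P†) ≃ₗᵢ[ℂ] defectSpace (P'†)} (h : CoincideVia P P' u v) (n : ℕ)
    (x : defectSpace P) : v (charRemainder P n 0 x) = charRemainder P' n 0 (u x) := by
  -- a relation valid for small `z ≠ 0` passes to the limit `z → 0`
  have limit : ∀ n, (∀ z : ℂ, z ≠ 0 → ‖z‖ < 1 →
      v (charRemainder P n z x) = charRemainder P' n z (u x)) →
      v (charRemainder P n 0 x) = charRemainder P' n 0 (u x) := by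
    intro n hn
    have h1 := (v.continuous.continuousAt.comp (continuousAt_charRemainder P n x)).tendsto.mono_left
      (nhdsWithin_le_nhds (s := {0}ᶜ))
    have h2 := (continuousAt_charRemainder P' n (u x)).tendsto.mono_left
      (nhdsWithin_le_nhds (s := {0}ᶜ))
    refine tendsto_nhds_unique (h1.congr' ?_) h2
    have hb : ∀ᶠ z : ℂ in 𝓝[≠] 0, z ∈ Metric.ball (0 : ℂ) 1 :=
      nhdsWithin_le_nhds (Metric.ball_mem_nhds 0 one_pos)
    filter_upwards [self_mem_nhdsWithin, hb] with z hz0 hz1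
    exact hn z hz0 (by simpa using hz1)
  have key : ∀ n, ∀ z : ℂ, z ≠ 0 → ‖z‖ < 1 →
      v (charRemainder P n z x) = charRemainder P' n z (u x) := by
    intro n
    induction n with
    | zero =>
      intro z hz0 hz1
      have e := h z hz1 x
      rw [charFun_eq_add P z, charFun_eq_add P' z, add_apply,
        add_apply, map_add, h 0 (by simp), add_right_inj,
        smul_apply, smul_apply, map_smul] at e
      exact smul_right_injective _ hz0 e
    | succ n ih =>
      intro z hz0 hz1
      have e := ih z hz0 hz1
      rw [charRemainder_eq_add hP n hz1, charRemainder_eq_add hP' n hz1,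
        add_apply, add_apply, map_add, limit n ih,
        add_right_inj, smul_apply, smul_apply,
        map_smul] at e
      exact smul_right_injective _ hz0 e
  exact limit n (key n)

/-! ### The vectors `Pᵏ D_{P*} e` -/

/-- The operator `e ↦ Pᵏ D_{P*} e` on the defect space of `P*`. It is the adjoint of the `k`-th
coefficient of the isometric embedding `h ↦ ∑ zᵏ D_{P*} P*ᵏ h` of `H` into the vector-valued Hardy
space, available when `P` is pure. -/
def orbitMap (P : H →L[ℂ] H) (k : ℕ) : defectSpace (P†) →L[ℂ] H :=
  (P ^ k) ∘L (defectMap (P†))†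

theorem orbitMap_zero_apply (P : H →L[ℂ] H) (e : defectSpace (P†)) :
    orbitMap P 0 e = defectOp (P†) e := by
  rw [← adjoint_defectMap_apply]; rfl

theorem orbitMap_succ_apply (P : H →L[ℂ] H) (k : ℕ) (e : defectSpace (P†)) :
    orbitMap P (k + 1) e = P (orbitMap P k e) := by
  simp [orbitMap, pow_succ']

theorem orbitMap_succ_apply' (P : H →L[ℂ] H) (k : ℕ) (e : defectSpace (P†)) :
    orbitMap P (k + 1) e = (P ^ k) (P (((defectMap (P†))†) e)) := by
  simp [orbitMap]

theorem adjoint_pow (P : H →L[ℂ] H) (k : ℕ) : (P ^ k)† = P† ^ k := star_pow P k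

theorem adjoint_charRemainder_zero_apply (P : H →L[ℂ] H) (k : ℕ) (e : defectSpace (P†)) :
    ((charRemainder P k 0)†) e = defectMap P (orbitMap P k e) := by
  have : (P† ^ k)† = P ^ k := by rw [← adjoint_pow, ContinuousLinearMap.adjoint_adjoint]
  simp [charRemainder, ContinuousLinearMap.adjoint_comp, this, orbitMap]

theorem adjoint_charFun_zero_apply (P : H →L[ℂ] H) (e : defectSpace (P†)) :
    (((charFun P 0)†) e : H) = -(P†) e := by
  have hm : (P†) e ∈ defectSpace P := by
    simpa using map_defectSpace (P†) e.2
  have : ((charFun P 0)†) e = ⟨-(P†) e, neg_mem hm⟩ := by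
    refine ext_inner_left ℂ fun x => ?_
    rw [ContinuousLinearMap.adjoint_inner_right, Submodule.coe_inner, Submodule.coe_inner,
      charFun_zero_apply, inner_neg_left, inner_neg_right, ContinuousLinearMap.adjoint_inner_right]
  rw [this]

/-- The degree `(0, 0)` coefficient of `(1 - z w̄) K(z, w) = I - Θ(z) Θ(w)*`, where
`K(z, w) = D_{P*} (I - z P*)⁻¹ (I - w̄ P)⁻¹ D_{P*}`. -/
theorem inner_orbitMap_zero_zero {P : H →L[ℂ] H} (hP : ‖P‖ ≤ 1) (e f : defectSpace (P†)) :
    inner ℂ (orbitMap P 0 e) (orbitMap P 0 f) =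
      inner ℂ e f - inner ℂ (((charFun P 0)†) e) (((charFun P 0)†) f) := by
  rw [Submodule.coe_inner _ e f, Submodule.coe_inner, adjoint_charFun_zero_apply,
    adjoint_charFun_zero_apply, inner_neg_neg, ContinuousLinearMap.adjoint_inner_left,
    ← inner_sub_right, orbitMap_zero_apply, orbitMap_zero_apply]
  nth_rewrite 1 [← defectOp_adjoint]
  rw [ContinuousLinearMap.adjoint_inner_left]
  congr 1
  exact DFunLike.congr_fun (defectOp_adjoint_mul_self hP) (f : H)

/-- The degree `(0, k + 1)` coefficient of `(1 - z w̄) K(z, w) = I - Θ(z) Θ(w)*`. -/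
theorem inner_orbitMap_zero_succ {P : H →L[ℂ] H} (hP : ‖P‖ ≤ 1) (k : ℕ) (e f : defectSpace (P†)) :
    inner ℂ (orbitMap P 0 e) (orbitMap P (k + 1) f) =
      -inner ℂ (((charFun P 0)†) e) (((charRemainder P k 0)†) f) := by
  rw [ContinuousLinearMap.adjoint_inner_left, adjoint_charRemainder_zero_apply,
    Submodule.coe_inner, charFun_zero_apply, inner_neg_right, neg_neg, orbitMap_zero_apply,
    orbitMap_succ_apply]
  nth_rewrite 1 [← defectOp_adjoint]
  rw [ContinuousLinearMap.adjoint_inner_left]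
  congr 1
  exact DFunLike.congr_fun (defectOp_adjoint_mul hP) _

/-- The degree `(j + 1, k + 1)` coefficient of `(1 - z w̄) K(z, w) = I - Θ(z) Θ(w)*`. -/
theorem inner_orbitMap_succ_succ {P : H →L[ℂ] H} (hP : ‖P‖ ≤ 1) (j k : ℕ)
    (e f : defectSpace (P†)) :
    inner ℂ (orbitMap P (j + 1) e) (orbitMap P (k + 1) f) =
      inner ℂ (orbitMap P j e) (orbitMap P k f) -
        inner ℂ (((charRemainder P j 0)†) e) (((charRemainder P k 0)†) f) := by
  rw [adjoint_charRemainder_zero_apply, adjoint_charRemainder_zero_apply, Submodule.coe_inner,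
    coe_defectMap, coe_defectMap, orbitMap_succ_apply, orbitMap_succ_apply]
  have h1 : inner ℂ (defectOp P (orbitMap P j e)) (defectOp P (orbitMap P k f)) =
      inner ℂ (orbitMap P j e) ((1 - P† * P) (orbitMap P k f)) := by
    nth_rewrite 1 [← defectOp_adjoint]
    rw [ContinuousLinearMap.adjoint_inner_left, ← defectOp_mul_self hP]
    rfl
  rw [h1, ← inner_sub_right, ← ContinuousLinearMap.adjoint_inner_right]
  congr 1
  simp

/-- The Gram operators of the vectors `Pᵏ D_{P*} e` are determined by the characteristic
function. -/
theorem CoincideVia.inner_orbitMap {P : H →L[ℂ] H} {P' : H' →L[ℂ] H'} (hP : ‖P‖ ≤ 1)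
    (hP' : ‖P'‖ ≤ 1) {u : defectSpace P ≃ₗᵢ[ℂ] defectSpace P'}
    {v : defectSpace (P†) ≃ₗᵢ[ℂ] defectSpace (P'†)} (h : CoincideVia P P' u v) (j k : ℕ)
    (e f : defectSpace (P†)) :
    inner ℂ (orbitMap P' j (v e)) (orbitMap P' k (v f)) =
      inner ℂ (orbitMap P j e) (orbitMap P k f) := by
  have h0 := map_adjoint_of_intertwines u v (h 0 (by simp))
  have hc := fun k => map_adjoint_of_intertwines u v (h.charRemainder_zero hP hP' k)
  have h0c := fun k e f => (congrArg₂ (inner ℂ) (h0 e) (hc k f)).symm.trans (u.inner_map_map _ _)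
  have hzs : ∀ k e f, inner ℂ (orbitMap P' 0 (v e)) (orbitMap P' (k + 1) (v f)) =
      inner ℂ (orbitMap P 0 e) (orbitMap P (k + 1) f) := fun k e f =>
    (inner_orbitMap_zero_succ hP' k (v e) (v f)).trans
      ((congrArg Neg.neg (h0c k e f)).trans (inner_orbitMap_zero_succ hP k e f).symm)
  induction j generalizing k with
  | zero =>
    cases k with
    | zero =>
      have h00 := (congrArg₂ (inner ℂ) (h0 e) (h0 f)).symm.trans (u.inner_map_map _ _)
      exact (inner_orbitMap_zero_zero hP' (v e) (v f)).trans
        ((congrArg₂ HSub.hSub (v.inner_map_map e f) h00).trans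
          (inner_orbitMap_zero_zero hP e f).symm)
    | succ k => exact hzs k e f
  | succ j ih =>
    cases k with
    | zero => rw [← inner_conj_symm, hzs, inner_conj_symm]
    | succ k =>
      have hcc := (congrArg₂ (inner ℂ) (hc j e) (hc k f)).symm.trans (u.inner_map_map _ _)
      exact (inner_orbitMap_succ_succ hP' j k (v e) (v f)).trans
        ((congrArg₂ HSub.hSub (ih k) hcc).trans (inner_orbitMap_succ_succ hP j k e f).symm)

/-- For a pure contraction the vectors `Pᵏ D_{P*} e` are total: on a vector orthogonal to all of
them the powers of `P*` act isometrically. -/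
theorem IsPure.eq_zero_of_inner_orbitMap {P : H →L[ℂ] H} (hpure : IsPure P) (hP : ‖P‖ ≤ 1) (h : H)
    (h0 : ∀ k e, inner ℂ (orbitMap P k e) h = 0) : h = 0 := by
  have hd : ∀ k, defectOp (P†) ((P† ^ k) h) = 0 := by
    intro k
    have : defectMap (P†) ((P† ^ k) h) = 0 := by
      refine ext_inner_left ℂ fun e => ?_
      rw [← ContinuousLinearMap.adjoint_inner_left, ← adjoint_pow,
        ContinuousLinearMap.adjoint_inner_right, inner_zero_right]
      exact h0 k e
    exact congrArg Subtype.val this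
  have hstep : ∀ k, ‖(P† ^ k) h‖ ≤ ‖(P† ^ (k + 1)) h‖ := by
    intro k
    have e := DFunLike.congr_fun (defectOp_adjoint_mul_self hP) ((P† ^ k) h)
    have e' : (P† ^ k) h = P ((P† ^ (k + 1)) h) := by
      have e1 : (0 : H) = (P† ^ k) h - P ((P†) ((P† ^ k) h)) := by
        rw [← map_zero (defectOp (P†)), ← hd k]; exact e
      rw [pow_succ']
      exact sub_eq_zero.1 e1.symm
    calc ‖(P† ^ k) h‖ = ‖P ((P† ^ (k + 1)) h)‖ := by rw [← e']
      _ ≤ ‖(P† ^ (k + 1)) h‖ := P.le_of_opNorm_le_of_le hP le_rfl |>.trans_eq (one_mul _)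
  have hle : ∀ k, ‖h‖ ≤ ‖(P† ^ k) h‖ := by
    intro k
    induction k with
    | zero => simp
    | succ k ih => exact ih.trans (hstep k)
  have := ge_of_tendsto' (hpure h).norm hle
  rw [norm_zero] at this
  exact norm_le_zero_iff.1 this

/-! ### Fundamental operator tuples -/

theorem IsFundamentalTuple.eq_adjoint_comp {m : ℕ} {S : Fin m → H →L[ℂ] H} {P : H →L[ℂ] H}
    {F : Fin m → defectSpace P →L[ℂ] defectSpace P} (h : IsFundamentalTuple S P F) (i : Fin m) :
    S i - (S (Fin.rev i))† * P = (defectMap P)† ∘L F i ∘L defectMap P := by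
  rw [h i]
  ext x
  simp [adjoint_defectMap_apply]

/-- The relation between fundamental operators and the action of `S_i`, for an arbitrary
factorization `Δ* Δ = I - P P*` with `Δ*` injective; `S` and `T` stand for `S_i` and `S_{n-i}`, and
`B` and `C` for `B_i` and `B_{n-i}`. -/
theorem comp_adjoint_of_fundamental {E : Type*} [NormedAddCommGroup E] [InnerProductSpace ℂ E]
    [CompleteSpace E] {S T P : H →L[ℂ] H} (hc : Commute S P) {Δ : H →L[ℂ] E} {B C : E →L[ℂ] E}
    (hΔ : Δ† ∘L Δ = 1 - P * P†) (hinj : Function.Injective (Δ†))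
    (hB : S† - T * P† = Δ† ∘L B ∘L Δ) (hC : T† - S * P† = Δ† ∘L C ∘L Δ) :
    S ∘L Δ† = Δ† ∘L B† + P ∘L Δ† ∘L C := by
  have hC' : T - P * S† = Δ† ∘L C† ∘L Δ := by
    have e : (S * P†)† = P * S† := by
      change (S ∘L P†)† = _
      rw [ContinuousLinearMap.adjoint_comp, ContinuousLinearMap.adjoint_adjoint]; rfl
    have := congrArg ContinuousLinearMap.adjoint hC
    rwa [ContinuousLinearMap.adjoint_comp, ContinuousLinearMap.adjoint_comp,
      ContinuousLinearMap.adjoint_adjoint, map_sub, ContinuousLinearMap.adjoint_adjoint, e] at this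
  have hc' : S† * P† = P† * S† := by
    have := congrArg star hc.eq
    rw [star_mul, star_mul] at this
    exact this.symm
  -- `Δ*` is injective, so the adjoint of the claim may be multiplied by it
  have key : Δ† ∘L (Δ ∘L S†) = Δ† ∘L (B ∘L Δ + C† ∘L Δ ∘L P†) := by
    calc Δ† ∘L (Δ ∘L S†) = (Δ† ∘L Δ) * S† := rfl
      _ = (S† - T * P†) + (T - P * S†) * P† := by
        rw [hΔ, sub_mul, sub_mul, one_mul, mul_assoc, mul_assoc, hc']; abel
      _ = _ := by rw [hB, hC', ContinuousLinearMap.comp_add]; rfl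
  have key' : Δ ∘L S† = B ∘L Δ + C† ∘L Δ ∘L P† := by
    ext x
    exact hinj (DFunLike.congr_fun key x)
  have h := congrArg ContinuousLinearMap.adjoint key'
  simpa only [ContinuousLinearMap.adjoint_comp, map_add, ContinuousLinearMap.adjoint_adjoint,
    ContinuousLinearMap.comp_assoc] using h

/-- The action of `S_i` on the vectors `Pᵏ D_{P*} e`: in the Hardy space model, `S_i` is the
compression of multiplication by `B_i* + z B_{n-i}`. -/
theorem IsFundamentalTuple.apply_orbitMap {m : ℕ} {S : Fin m → H →L[ℂ] H} {P : H →L[ℂ] H}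
    (hP : ‖P‖ ≤ 1) (hc : ∀ i, Commute (S i) P)
    {B : Fin m → defectSpace (P†) →L[ℂ] defectSpace (P†)}
    (hB : IsFundamentalTuple (fun i => (S i)†) (P†) B) (i : Fin m) (k : ℕ)
    (e : defectSpace (P†)) :
    S i (orbitMap P k e) = orbitMap P k (((B i)†) e) + orbitMap P (k + 1) (B (Fin.rev i) e) := by
  have h1 : (S i)† - S (Fin.rev i) * P† =
      (defectMap (P†))† ∘L B i ∘L defectMap (P†) := by
    have := hB.eq_adjoint_comp i
    rwa [ContinuousLinearMap.adjoint_adjoint] at this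
  have h2 : (S (Fin.rev i))† - S i * P† =
      (defectMap (P†))† ∘L B (Fin.rev i) ∘L defectMap (P†) := by
    have := hB.eq_adjoint_comp (Fin.rev i)
    rwa [Fin.rev_rev, ContinuousLinearMap.adjoint_adjoint] at this
  have h3 : (defectMap (P†))† ∘L defectMap (P†) = 1 - P * P† := by
    rw [← defectOp_adjoint_mul_self hP]
    ext x
    exact adjoint_defectMap_apply _ _
  have h4 : Function.Injective ((defectMap (P†))†) := by
    intro x y hxy
    rw [adjoint_defectMap_apply, adjoint_defectMap_apply] at hxy
    exact defectOp_injOn hxy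
  have h := DFunLike.congr_fun (comp_adjoint_of_fundamental (hc i) h3 h4 h1 h2) e
  have hk : S i * P ^ k = P ^ k * S i := ((hc i).pow_right k).eq
  calc S i (orbitMap P k e) = (S i * P ^ k) (((defectMap (P†))†) e) := rfl
    _ = (P ^ k) ((S i ∘L (defectMap (P†))†) e) :=
      DFunLike.congr_fun hk (((defectMap (P†))†) e)
    _ = (P ^ k) (((defectMap (P†))†) (((B i)†) e) + P (((defectMap (P†))†) (B (Fin.rev i) e))) :=
      congrArg _ h
    _ = (P ^ k) (((defectMap (P†))†) (((B i)†) e)) +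
        (P ^ k) (P (((defectMap (P†))†) (B (Fin.rev i) e))) := map_add _ _ _
    _ = _ := congrArg _ (orbitMap_succ_apply' P k _).symm

/-- Unitaries that intertwine the tuples `(S, P)` and `(S', P')` intertwine the fundamental
operators of the adjoint tuples. -/
theorem IsFundamentalTuple.intertwines {m : ℕ} {S : Fin m → H →L[ℂ] H} {P : H →L[ℂ] H}
    {S' : Fin m → H' →L[ℂ] H'} {P' : H' →L[ℂ] H'}
    {B : Fin m → defectSpace (P†) →L[ℂ] defectSpace (P†)}
    {B' : Fin m → defectSpace (P'†) →L[ℂ] defectSpace (P'†)}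
    (hB : IsFundamentalTuple (fun i => (S i)†) (P†) B)
    (hB' : IsFundamentalTuple (fun i => (S' i)†) (P'†) B') (hP : ‖P‖ ≤ 1) (hP' : ‖P'‖ ≤ 1)
    (U : H ≃ₗᵢ[ℂ] H') (hUS : ∀ i x, U (S i x) = S' i (U x)) (hUP : ∀ x, U (P x) = P' (U x))
    (v : defectSpace (P†) ≃ₗᵢ[ℂ] defectSpace (P'†)) (hv : ∀ x, (v x : H') = U x) :
    Intertwines v B B' := by
  have hUPa := map_adjoint_of_intertwines U U hUP
  have hD := map_defectOp (P := P†) (P' := P'†) (by simpa using hP) (by simpa using hP') U hUPa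
  have hvD : ∀ w, v (defectMap (P†) w) = defectMap (P'†) (U w) := fun w =>
    Subtype.ext ((hv _).trans (hD w))
  -- it suffices to check the identity on the range of `D_{P*}`, and after applying `D_{P'*}`
  intro i y
  refine (denseRange_defectMap (P†)).induction_on
    (p := fun y => v (B i y) = B' i (v y)) y (isClosed_eq (by fun_prop) (by fun_prop)) fun w => ?_
  apply defectOp_injOn
  have h1 : (((S i)†) w - ((S (Fin.rev i))††) ((P†) w)) =
      defectOp (P†) (B i (defectMap (P†) w)) := DFunLike.congr_fun (hB i) w
  have h2 : (((S' i)†) (U w) - ((S' (Fin.rev i))††) ((P'†) (U w))) =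
      defectOp (P'†) (B' i (defectMap (P'†) (U w))) := DFunLike.congr_fun (hB' i) (U w)
  rw [ContinuousLinearMap.adjoint_adjoint] at h1 h2
  rw [hvD, hv, ← hD, ← h1, ← h2, map_sub, map_adjoint_of_intertwines U U (hUS i), hUS, hUPa]

/-! ### Invariance of the characteristic function -/

/-- A unitary that intertwines two contractions intertwines the operators that define their
characteristic functions. -/
theorem map_charOp {P : H →L[ℂ] H} {P' : H' →L[ℂ] H'} (hP : ‖P‖ ≤ 1) (hP' : ‖P'‖ ≤ 1)
    (U : H ≃ₗᵢ[ℂ] H') (h : ∀ x, U (P x) = P' (U x)) {z : ℂ} (hz : ‖z‖ < 1) (x : H) :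
    U (charOp P z x) = charOp P' z (U x) := by
  have ha := map_adjoint_of_intertwines U U h
  set R : H →L[ℂ] H := Ring.inverse (1 - z • P†) with hR
  set R' : H' →L[ℂ] H' := Ring.inverse (1 - z • P'†) with hR'
  have h1 : ∀ y, R y - z • (P†) (R y) = y :=
    DFunLike.congr_fun (Ring.mul_inverse_cancel _ (isUnit_one_sub_smul_adjoint hP hz))
  have h2 : ∀ y, R' (y - z • (P'†) y) = y :=
    DFunLike.congr_fun (Ring.inverse_mul_cancel _ (isUnit_one_sub_smul_adjoint hP' hz))
  have hUR : ∀ y, U (R y) = R' (U y) := by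
    intro y
    rw [← h2 (U (R y)), ← ha, ← map_smul, ← map_sub, h1]
  change U (-P x + z • defectOp (P†) (R (defectOp P x))) =
    -P' (U x) + z • defectOp (P'†) (R' (defectOp P' (U x)))
  rw [map_add, map_neg, map_smul, h,
    map_defectOp (P := P†) (P' := P'†) (by simpa using hP) (by simpa using hP') U ha, hUR,
    map_defectOp hP hP' U h]

/-! ### The two implications -/

/-- Unitarily equivalent contractions have coinciding characteristic functions. -/
theorem coincideVia_of_unitary {P : H →L[ℂ] H} {P' : H' →L[ℂ] H'} (hP : ‖P‖ ≤ 1) (hP' : ‖P'‖ ≤ 1)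
    (U : H ≃ₗᵢ[ℂ] H') (h : ∀ x, U (P x) = P' (U x))
    {u : defectSpace P ≃ₗᵢ[ℂ] defectSpace P'} (hu : ∀ x, (u x : H') = U x)
    {v : defectSpace (P†) ≃ₗᵢ[ℂ] defectSpace (P'†)} (hv : ∀ x, (v x : H') = U x) :
    CoincideVia P P' u v := by
  intro z hz x
  refine Subtype.ext ((hv _).trans ?_)
  change U (charOp P z x) = charOp P' z (u x)
  rw [hu, map_charOp hP hP' U h hz]

/-- A unitary that matches the vectors `Pᵏ D_{P*} e` intertwines the tuples, if the fundamental
operators of the adjoint tuples correspond. -/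
theorem intertwines_of_map_orbitMap {m : ℕ} {S : Fin m → H →L[ℂ] H} {P : H →L[ℂ] H}
    {S' : Fin m → H' →L[ℂ] H'} {P' : H' →L[ℂ] H'}
    (hT : IsPureGamContraction S P) (hT' : IsPureGamContraction S' P')
    {B : Fin m → defectSpace (P†) →L[ℂ] defectSpace (P†)}
    {B' : Fin m → defectSpace (P'†) →L[ℂ] defectSpace (P'†)}
    (hB : IsFundamentalTuple (fun i => (S i)†) (P†) B)
    (hB' : IsFundamentalTuple (fun i => (S' i)†) (P'†) B')
    {v : defectSpace (P†) ≃ₗᵢ[ℂ] defectSpace (P'†)} (hv : Intertwines v B B')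
    (U : H ≃ₗᵢ[ℂ] H') (hU : ∀ k e, U (orbitMap P k e) = orbitMap P' k (v e)) :
    Intertwines U (tuple S P) (tuple S' P') := by
  have hdense := denseRange_lsum (orbitMap P) (hT.pure.eq_zero_of_inner_orbitMap hT.norm_le_one)
  -- it suffices to compare the operators on the total set of vectors `Pᵏ D_{P*} e`
  have ext : ∀ (A : H →L[ℂ] H) (A' : H' →L[ℂ] H'),
      (∀ k e, U (A (orbitMap P k e)) = A' (U (orbitMap P k e))) → ∀ x, U (A x) = A' (U x) := by
    intro A A' h x
    refine hdense.induction_on (p := fun x => U (A x) = A' (U x)) x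
      (isClosed_eq (by fun_prop) (by fun_prop)) fun f => ?_
    simp only [Finsupp.lsum_apply, Finsupp.sum, map_sum, ContinuousLinearMap.coe_coe, h]
  intro i
  refine Fin.lastCases ?_ (fun i => ?_) i
  · simp only [tuple, Fin.snoc_last]
    refine ext P P' fun k e => ?_
    rw [← orbitMap_succ_apply, hU, hU, orbitMap_succ_apply]
  · simp only [tuple, Fin.snoc_castSucc]
    refine ext (S i) (S' i) fun k e => ?_
    calc U (S i (orbitMap P k e))
        = U (orbitMap P k (((B i)†) e)) + U (orbitMap P (k + 1) (B (Fin.rev i) e)) :=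
          (congrArg U (hB.apply_orbitMap hT.norm_le_one hT.commute i k e)).trans (map_add U _ _)
      _ = orbitMap P' k (v (((B i)†) e)) + orbitMap P' (k + 1) (v (B (Fin.rev i) e)) :=
          congrArg₂ HAdd.hAdd (hU _ _) (hU _ _)
      _ = orbitMap P' k (((B' i)†) (v e)) + orbitMap P' (k + 1) (B' (Fin.rev i) (v e)) :=
          congrArg₂ (fun x y => orbitMap P' k x + orbitMap P' (k + 1) y)
            (map_adjoint_of_intertwines v v (hv i) e) (hv _ e)
      _ = S' i (orbitMap P' k (v e)) :=
          (hB'.apply_orbitMap hT'.norm_le_one hT'.commute i k (v e)).symm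
      _ = S' i (U (orbitMap P k e)) := congrArg _ (hU k e).symm

end SymPoly

end

theorem theorem3p14 {m : ℕ} (hm : 1 ≤ m)
    {H : Type*} [NormedAddCommGroup H] [InnerProductSpace ℂ H] [CompleteSpace H]
    {H' : Type*} [NormedAddCommGroup H'] [InnerProductSpace ℂ H'] [CompleteSpace H']
    (S : Fin m → H →L[ℂ] H) (P : H →L[ℂ] H)
    (S' : Fin m → H' →L[ℂ] H') (P' : H' →L[ℂ] H')
    (hT : SymPoly.IsPureGamContraction S P) (hT' : SymPoly.IsPureGamContraction S' P')
    (B : Fin m → SymPoly.defectSpace (P†) →L[ℂ] SymPoly.defectSpace (P†))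
    (B' : Fin m → SymPoly.defectSpace (P'†) →L[ℂ] SymPoly.defectSpace (P'†))
    (hB : SymPoly.IsFundamentalTuple (fun i => (S i)†) (P†) B)
    (hB' : SymPoly.IsFundamentalTuple (fun i => (S' i)†) (P'†) B') :
    SymPoly.UnitarilyEquivalent (SymPoly.tuple S P) (SymPoly.tuple S' P') ↔
      ∃ (u : SymPoly.defectSpace P ≃ₗᵢ[ℂ] SymPoly.defectSpace P')
        (v : SymPoly.defectSpace (P†) ≃ₗᵢ[ℂ] SymPoly.defectSpace (P'†)),
        SymPoly.CoincideVia P P' u v ∧ SymPoly.Intertwines v B B' := by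
  have hP := hT.norm_le_one
  have hP' := hT'.norm_le_one
  constructor
  · rintro ⟨U, hU⟩
    have hUP : ∀ x, U (P x) = P' (U x) := fun x => by
      simpa [SymPoly.tuple] using hU (Fin.last m) x
    have hUS : ∀ i x, U (S i x) = S' i (U x) := fun i x => by
      simpa [SymPoly.tuple] using hU i.castSucc x
    obtain ⟨u, hu⟩ := SymPoly.exists_defectSpace_unitary hP hP' U hUP
    obtain ⟨v, hv⟩ := SymPoly.exists_defectSpace_unitary (P := P†) (P' := P'†) (by simpa using hP)
      (by simpa using hP') U (SymPoly.map_adjoint_of_intertwines U U hUP)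
    exact ⟨u, v, SymPoly.coincideVia_of_unitary hP hP' U hUP hu hv,
      hB.intertwines hB' hP hP' U hUS hUP v hv⟩
  · rintro ⟨u, v, huv, hv⟩
    obtain ⟨U, hU⟩ := SymPoly.exists_unitary_of_gram_eq (SymPoly.orbitMap P) (SymPoly.orbitMap P') v
      (huv.inner_orbitMap hP hP') (hT.pure.eq_zero_of_inner_orbitMap hP)
      (hT'.pure.eq_zero_of_inner_orbitMap hP')
    exact ⟨U, SymPoly.intertwines_of_map_orbitMap hT hT' hB hB' hv U hU⟩
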